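/- Let $A$ be an $n\times m$ integer matrix that is unimodular, i.e. $\operatorname{rank} A=n$ and every minor of $A$ of order $n$ belongs to $\{0,1,-1\}$. A polyhedron in $\mathbb{R}^n$ is a set $\{x : Cx\le b\}$ given by finitely many linear inequalities; it is an integer polyhedron if it is the convex hull of its integer points. A face of a polyhedron $P$ is a nonempty set of the form $\{x\in P : \langle c,x\rangle=\max_{y\in P}\langle c,y\rangle\}$ with $c\in\mathbb{R}^n$ ($c=0$ gives $P$ itself). Let $\mathcal{P}_A$ be the family of all integer polyhedra $P\subseteq\mathbb{R}^n$ such that, for every face $F$ of $P$, the linear span of $F-F$ is generated by a (possibly empty) set of columns of $A$, and let $\mathcal{C}_A=\{P\cap\mathbb{Z}^n : P\in\mathcal{P}_A\}$. Write $\overline{S}$ for the convex hull of $S$. Then: 1. (DCP1) each $P\in\mathcal{P}_A$ is an integer polyhedron; 2. (DCP2) for all $P_1,P_2\in\mathcal{P}_A$, the Minkowski sum $P_1+P_2$ belongs to $\mathcal{P}_A$, and $(P_1+P_2)\cap\mathbb{Z}^n=(P_1\cap\mathbb{Z}^n)+(P_2\cap\mathbb{Z}^n)$; 3. (DC1) for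 every $S\in\mathcal{C}_A$, $\overline{S}$ is an integer polyhedron and $S=\overline{S}\cap\mathbb{Z}^n$; 4. (DC2) for all $S_1,S_2\in\mathcal{C}_A$, $S_1+S_2\in\mathcal{C}_A$. -/

import Mathlib

open scoped Pointwise Matrix

namespace DiscreteConvexity

/-- The set `ℤⁿ`, regarded as a subset of `ℝⁿ`. -/
def intPoints (n : ℕ) : Set (Fin n → ℝ) :=
  {x | ∀ i, ∃ k : ℤ, x i = (k : ℝ)}

/-- A polyhedron: the solution set of a finite system of linear inequalities `C x ≤ b`. -/
def IsPolyhedron {n : ℕ} (P : Set (Fin n → ℝ)) : Prop :=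
  ∃ (k : ℕ) (C : Matrix (Fin k) (Fin n) ℝ) (b : Fin k → ℝ), P = {x | C *ᵥ x ≤ b}

/-- An integer polyhedron: a polyhedron that is the convex hull of its integer points. -/
def IsIntegerPolyhedron {n : ℕ} (P : Set (Fin n → ℝ)) : Prop :=
  IsPolyhedron P ∧ P = convexHull ℝ (P ∩ intPoints n)

/-- An `n × m` integer matrix is unimodular if it has rank `n` and each of its minors of
order `n` belongs to `{0, 1, -1}`. -/
def IsUnimodular {n m : ℕ} (A : Matrix (Fin n) (Fin m) ℤ) : Prop :=
  (A.map (Int.cast : ℤ → ℝ)).rank = n ∧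
    ∀ f : Fin n → Fin m, Function.Injective f →
      (A.submatrix id f).det = 0 ∨ (A.submatrix id f).det = 1 ∨ (A.submatrix id f).det = -1

/-- The `j`-th column of an integer matrix, as a vector of `ℝⁿ`. -/
def column {n m : ℕ} (A : Matrix (Fin n) (Fin m) ℤ) (j : Fin m) : Fin n → ℝ :=
  fun i => (A i j : ℝ)

/-- A nonempty face of `P`: the nonempty set of maximizers over `P` of some linear functional
(the zero functional gives `P` itself). -/
def IsFace {n : ℕ} (P F : Set (Fin n → ℝ)) : Prop :=
  F.Nonempty ∧ IsExposed ℝ P F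

/-- The family `P_A`: integer polyhedra such that, for each face `F`, the linear span of `F - F`
is generated by a (possibly empty) set of columns of `A`. -/
def polyhedraOf {n m : ℕ} (A : Matrix (Fin n) (Fin m) ℤ) : Set (Set (Fin n → ℝ)) :=
  {P | IsIntegerPolyhedron P ∧
    ∀ F, IsFace P F →
      ∃ J : Set (Fin m), vectorSpan ℝ F = Submodule.span ℝ (column A '' J)}

/-- The family of sets `P ∩ ℤⁿ` with `P` in a given family `Ps`. -/
def discreteFamily {n : ℕ} (Ps : Set (Set (Fin n → ℝ))) : Set (Set (Fin n → ℝ)) :=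
  {S | ∃ P ∈ Ps, S = P ∩ intPoints n}

/-- Each member of `Ps` is an integer polyhedron. -/
def DCP1 {n : ℕ} (Ps : Set (Set (Fin n → ℝ))) : Prop :=
  ∀ P ∈ Ps, IsIntegerPolyhedron P

/-- `Ps` is closed under Minkowski sum, and the integer points of a sum are the sums of integer
points. -/
def DCP2 {n : ℕ} (Ps : Set (Set (Fin n → ℝ))) : Prop :=
  ∀ P₁ ∈ Ps, ∀ P₂ ∈ Ps, P₁ + P₂ ∈ Ps ∧
    (P₁ + P₂) ∩ intPoints n = (P₁ ∩ intPoints n) + (P₂ ∩ intPoints n)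

/-- Each member of `Cs` is hole-free, and its convex hull is an integer polyhedron. -/
def DC1 {n : ℕ} (Cs : Set (Set (Fin n → ℝ))) : Prop :=
  ∀ S ∈ Cs, IsIntegerPolyhedron (convexHull ℝ S) ∧ S = convexHull ℝ S ∩ intPoints n

/-- `Cs` is closed under Minkowski sum. -/
def DC2 {n : ℕ} (Cs : Set (Set (Fin n → ℝ))) : Prop :=
  ∀ S₁ ∈ Cs, ∀ S₂ ∈ Cs, S₁ + S₂ ∈ Cs

end DiscreteConvexity

/-!
DCP1 is part of the definition of the family, DC1 says that an integer polyhedron is the convex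
hull of its integer points, and DC2 is the discrete reading of DCP2. The content is DCP2.

*Closure under sums.* A sum of polyhedra is a linear projection of a polyhedron, so it is a
polyhedron by Fourier–Motzkin elimination (`IsPolyhedral.add`). It is the convex hull of its integer
points because convex hulls commute with sums. A face of `P₁ + P₂` is the sum of the faces of `P₁`
and `P₂` exposed by the same functional (`IsFace.exists_add`), so its direction space is the sum of
theirs, and is again spanned by columns of `A`.

*Integer points of sums.* Let `x ∈ P₁ + P₂` be an integer point and consider the polyhedron
`Q = P₁ ∩ (x - P₂)`. A point `y ∈ Q` at which as many constraints as possible are active has the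
property that `Q` contains `y + w` as soon as `w` is killed by the active constraints
(`exists_add_mem_of_active`). Let `F₁ ∋ y` and `F₂ ∋ x - y` be the faces of `P₁` and `P₂` cut out by
the active constraints, with direction spaces `V₁` and `V₂`; then `y + (V₁ ∩ V₂) ⊆ Q`. Both faces
contain integer points `a₁`, `a₂`, and `x - a₁ - a₂` is an integer vector of `V₁ + V₂`. Since `V₁` and
`V₂` are spanned by columns of the unimodular matrix `A`, Cramer's rule splits this vector into
integer vectors `v₁ ∈ V₁` and `v₂ ∈ V₂` (`IsUnimodular.exists_add_of_mem_sup`). Then `a₁ + v₁` is an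
integer point of `y + (V₁ ∩ V₂)`, and `x = (a₁ + v₁) + (a₂ + v₂)` is the required decomposition.
-/

namespace DiscreteConvexity

/-! ### Polyhedra and Fourier–Motzkin elimination -/

section Polyhedral

variable {E E' : Type*} [AddCommGroup E] [Module ℝ E] [AddCommGroup E'] [Module ℝ E']

/-- A polyhedron in an arbitrary real vector space: the solution set of finitely many linear
inequalities, over an arbitrary finite index type. -/
def IsPolyhedral (P : Set E) : Prop :=
  ∃ (ι : Type) (_ : Finite ι) (f : ι → Module.Dual ℝ E) (b : ι → ℝ), P = {x | ∀ i, f i x ≤ b i}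

lemma IsPolyhedral.inter {P Q : Set E} (hP : IsPolyhedral P) (hQ : IsPolyhedral Q) :
    IsPolyhedral (P ∩ Q) := by
  obtain ⟨ι, _, f, b, rfl⟩ := hP
  obtain ⟨κ, _, g, c, rfl⟩ := hQ
  refine ⟨ι ⊕ κ, inferInstance, Sum.elim f g, Sum.elim b c, ?_⟩
  ext x
  simp

lemma IsPolyhedral.preimage {P : Set E'} (hP : IsPolyhedral P) (T : E →ₗ[ℝ] E') :
    IsPolyhedral (T ⁻¹' P) := by
  obtain ⟨ι, _, f, b, rfl⟩ := hP
  exact ⟨ι, inferInstance, fun i => f i ∘ₗ T, b, rfl⟩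

/-- One-variable case of Fourier–Motzkin elimination: a finite system `t * a i ≤ c i` is solvable
as soon as its constraints without `t` hold and every lower bound it imposes on `t` is at most every
upper bound. -/
lemma exists_forall_mul_le {ι : Type*} [Finite ι] (a c : ι → ℝ) (h0 : ∀ i, a i = 0 → 0 ≤ c i)
    (h : ∀ i j, 0 < a i → a j < 0 → c j / a j ≤ c i / a i) : ∃ t : ℝ, ∀ i, t * a i ≤ c i := by
  obtain ⟨t, hlo, hup⟩ : ∃ t : ℝ, (∀ j, a j < 0 → c j / a j ≤ t) ∧
      ∀ i, 0 < a i → t ≤ c i / a i := by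
    rcases Set.eq_empty_or_nonempty {j | a j < 0} with hN | hN
    · obtain ⟨t, ht⟩ := (Set.finite_range fun i => c i / a i).bddBelow
      refine ⟨t, fun j hj => ?_, fun i _ => ht ⟨i, rfl⟩⟩
      have : j ∈ {j | a j < 0} := hj
      simp [hN] at this
    · obtain ⟨j, hj, hmax⟩ := Set.exists_max_image {j | a j < 0} (fun j => c j / a j)
        (Set.toFinite _) hN
      exact ⟨c j / a j, fun i hi => hmax i hi, fun i hi => h i j hi hj⟩
  refine ⟨t, fun i => ?_⟩
  rcases lt_trichotomy (a i) 0 with hi | hi | hi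
  · exact (div_le_iff_of_neg hi).1 (hlo i hi)
  · simpa [hi] using h0 i hi
  · exact (le_div_iff₀ hi).1 (hup i hi)

/-- Fourier–Motzkin elimination of one direction. -/
lemma IsPolyhedral.exists_add_smul_mem {P : Set E} (hP : IsPolyhedral P) (v : E) :
    IsPolyhedral {x | ∃ t : ℝ, x + t • v ∈ P} := by
  obtain ⟨ι, _, f, b, rfl⟩ := hP
  -- Keep the constraints that do not involve `v`, and combine each constraint bounding the
  -- coefficient of `v` from above with each one bounding it from below.
  refine ⟨{i // f i v = 0} ⊕ {p : ι × ι // 0 < f p.1 v ∧ f p.2 v < 0}, inferInstance,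
    Sum.elim (fun i => f i) (fun p => f p.1.1 v • f p.1.2 - f p.1.2 v • f p.1.1),
    Sum.elim (fun i => b i) (fun p => f p.1.1 v * b p.1.2 - f p.1.2 v * b p.1.1), ?_⟩
  ext x
  simp only [Set.mem_ofPred_eq, map_add, map_smul, smul_eq_mul, Sum.forall, Sum.elim_inl,
    Sum.elim_inr, Subtype.forall, Prod.forall, LinearMap.sub_apply, LinearMap.smul_apply]
  constructor
  · rintro ⟨t, ht⟩
    refine ⟨fun i hi => by simpa [hi] using ht i, fun i j hij => ?_⟩
    have h1 := mul_le_mul_of_nonneg_left (ht j) hij.1.le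
    have h2 := mul_le_mul_of_nonneg_left (ht i) (neg_nonneg.2 hij.2.le)
    linarith
  · rintro ⟨h0, h⟩
    obtain ⟨t, ht⟩ := exists_forall_mul_le (fun i => f i v) (fun i => b i - f i x)
      (fun i hi => sub_nonneg.2 (h0 i hi)) (fun i j hi hj => by
        rw [div_le_iff_of_neg hj, div_mul_eq_mul_div, div_le_iff₀ hi]
        linarith [h i j ⟨hi, hj⟩])
    exact ⟨t, fun i => by linarith [ht i]⟩

lemma IsPolyhedral.exists_add_mem {P : Set E} (hP : IsPolyhedral P) (N : Submodule ℝ E)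
    (hN : N.FG) : IsPolyhedral {x | ∃ w ∈ N, x + w ∈ P} := by
  induction N, hN using Submodule.fg_induction generalizing P with
  | singleton v =>
    convert hP.exists_add_smul_mem v using 3
    simp [Submodule.mem_span_singleton]
  | sup N₁ N₂ _ _ h₁ h₂ =>
    convert h₁ (h₂ hP) using 1
    ext x
    simp only [Set.mem_ofPred_eq, Submodule.mem_sup]
    constructor
    · rintro ⟨_, ⟨w₁, hw₁, w₂, hw₂, rfl⟩, hx⟩
      exact ⟨w₁, hw₁, w₂, hw₂, by rwa [add_assoc]⟩
    · rintro ⟨w₁, hw₁, w₂, hw₂, hx⟩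
      exact ⟨_, ⟨w₁, hw₁, w₂, hw₂, rfl⟩, by rwa [← add_assoc]⟩

lemma IsPolyhedral.add [FiniteDimensional ℝ E] {P Q : Set E} (hP : IsPolyhedral P)
    (hQ : IsPolyhedral Q) : IsPolyhedral (P + Q) := by
  -- `P + Q` is the first projection of the set of pairs `(x, z)` with `z ∈ P` and `x - z ∈ Q`.
  have hT := (hP.preimage (LinearMap.snd ℝ E E)).inter
    (hQ.preimage (LinearMap.fst ℝ E E - LinearMap.snd ℝ E E))
  convert (hT.exists_add_mem (LinearMap.range (LinearMap.inr ℝ E E))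
    (IsNoetherian.noetherian _)).preimage (LinearMap.inl ℝ E E) using 1
  ext x
  simp only [Set.mem_add, Set.mem_preimage, Set.mem_ofPred_eq, LinearMap.mem_range,
    exists_exists_eq_and, LinearMap.inl_apply, LinearMap.inr_apply, Set.mem_inter_iff,
    LinearMap.snd_apply, LinearMap.fst_apply, LinearMap.sub_apply, Prod.mk_add_mk, zero_add,
    add_zero]
  constructor
  · rintro ⟨y, hy, z, hz, rfl⟩
    exact ⟨y, hy, by simpa using hz⟩
  · rintro ⟨z, hz, hxz⟩
    exact ⟨z, hz, x - z, hxz, by simp⟩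

end Polyhedral

lemma isPolyhedron_iff_isPolyhedral {n : ℕ} {P : Set (Fin n → ℝ)} :
    IsPolyhedron P ↔ IsPolyhedral P := by
  constructor
  · rintro ⟨k, C, b, rfl⟩
    exact ⟨Fin k, inferInstance, fun i => LinearMap.proj i ∘ₗ C.mulVecLin, b, rfl⟩
  · rintro ⟨ι, _, f, b, rfl⟩
    have e := Finite.equivFin ι
    refine ⟨Nat.card ι, LinearMap.toMatrix' (LinearMap.pi fun i => f (e.symm i)),
      fun i => b (e.symm i), ?_⟩
    ext x
    simp [LinearMap.toMatrix'_mulVec, Pi.le_def,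
      e.symm.forall_congr_right (q := fun i => f i x ≤ b i)]

/-! ### Active constraints and faces -/

/-- A nonempty polyhedron contains a point, namely one with the most active constraints, from
which one can move along every vector that the active constraints kill. -/
lemma exists_add_mem_of_active {E ι : Type*} [AddCommGroup E] [Module ℝ E] [Finite ι]
    (f : ι → Module.Dual ℝ E) (b : ι → ℝ) (hne : ∃ x, ∀ i, f i x ≤ b i) :
    ∃ y, (∀ i, f i y ≤ b i) ∧
      ∀ w, (∀ i, f i y = b i → f i w = 0) → ∀ i, f i (y + w) ≤ b i := by
  obtain ⟨S, ⟨y, hy, rfl⟩, hmax⟩ := Set.exists_max_image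
    {S : Set ι | ∃ y, (∀ i, f i y ≤ b i) ∧ {i | f i y = b i} = S} Set.ncard (Set.toFinite _)
    (hne.imp' (fun x => {i | f i x = b i}) fun x hx => ⟨x, hx, rfl⟩)
  refine ⟨y, hy, fun w hw => ?_⟩
  -- Otherwise moving along `w` until the first new constraint becomes active contradicts the
  -- choice of `y`.
  suffices h : ∀ i, f i w ≤ 0 from fun i => by rw [map_add]; linarith [hy i, h i]
  by_contra! hpos
  obtain ⟨j, hj, hmin⟩ := Set.exists_min_image {i | 0 < f i w} (fun i => (b i - f i y) / f i w)
    (Set.toFinite _) hpos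
  simp only [Set.mem_ofPred_eq] at hj hmin
  set t := (b j - f j y) / f j w with ht
  have ht0 : 0 ≤ t := div_nonneg (sub_nonneg.2 (hy j)) hj.le
  have hmem : ∀ i, f i (y + t • w) ≤ b i := fun i => by
    rw [map_add, map_smul, smul_eq_mul]
    rcases le_or_gt (f i w) 0 with hi | hi
    · nlinarith [hy i, mul_nonneg ht0 (neg_nonneg.2 hi)]
    · linarith [(le_div_iff₀ hi).1 (hmin i hi)]
  refine (hmax _ ⟨y + t • w, hmem, rfl⟩).not_gt (Set.ncard_lt_ncard ?_ (Set.toFinite _))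
  refine Set.ssubset_iff_exists.2 ⟨fun i hi => ?_, j, ?_, fun hjy => hj.ne' (hw j hjy)⟩
  · simpa [hw i hi] using hi
  · simp [ht, div_mul_cancel₀ _ hj.ne']

/-- The face cut out by the constraints active at `y`: it is exposed by their sum. -/
lemma exists_isFace_active {n : ℕ} {ι : Type*} [Finite ι] (f : ι → Module.Dual ℝ (Fin n → ℝ))
    (b : ι → ℝ) {y : Fin n → ℝ} (hy : ∀ i, f i y ≤ b i) :
    ∃ F, IsFace {x | ∀ i, f i x ≤ b i} F ∧ y ∈ F ∧
      ∀ w ∈ vectorSpan ℝ F, ∀ i, f i y = b i → f i w = 0 := by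
  classical
  cases nonempty_fintype ι
  set I : Finset ι := Finset.univ.filter fun i => f i y = b i with hI
  set l : StrongDual ℝ (Fin n → ℝ) := LinearMap.toContinuousLinearMap (∑ i ∈ I, f i) with hl
  have hlx : ∀ x, l x = ∑ i ∈ I, f i x := fun x => by simp [hl]
  have hyl : l y = ∑ i ∈ I, b i := by
    rw [hlx]
    exact Finset.sum_congr rfl fun i hi => (Finset.mem_filter.1 hi).2
  have hyF : y ∈ {x ∈ {x | ∀ i, f i x ≤ b i} | ∀ z ∈ {x | ∀ i, f i x ≤ b i}, l z ≤ l x} :=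
    ⟨hy, fun z hz => by rw [hyl, hlx]; exact Finset.sum_le_sum fun i _ => hz i⟩
  refine ⟨_, ⟨⟨y, hyF⟩, fun _ => ⟨l, rfl⟩⟩, hyF, fun w hw i hi => ?_⟩
  have hact : ∀ x ∈ {x ∈ {x | ∀ i, f i x ≤ b i} | ∀ z ∈ {x | ∀ i, f i x ≤ b i}, l z ≤ l x},
      f i x = b i := fun x hx => by
    have h1 := hx.2 y hy
    rw [hyl, hlx] at h1
    exact (Finset.sum_eq_sum_iff_of_le fun i _ => hx.1 i).1
      (le_antisymm (Finset.sum_le_sum fun i _ => hx.1 i) h1) i (by simp [hI, hi])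
  have hle : vectorSpan ℝ {x ∈ {x | ∀ i, f i x ≤ b i} |
      ∀ z ∈ {x | ∀ i, f i x ≤ b i}, l z ≤ l x} ≤ LinearMap.ker (f i) := by
    rw [vectorSpan_def, Submodule.span_le]
    rintro _ ⟨u, hu, v, hv, rfl⟩
    simp [hact u hu, hact v hv]
  exact hle hw

/-- Every face of an integer polyhedron contains an integer point. -/
lemma IsFace.exists_mem_intPoints {n : ℕ} {P F : Set (Fin n → ℝ)}
    (hP : P = convexHull ℝ (P ∩ intPoints n)) (hF : IsFace P F) : ∃ a ∈ F, a ∈ intPoints n := by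
  obtain ⟨⟨y, hy⟩, hexp⟩ := hF
  obtain ⟨l, rfl⟩ := hexp ⟨y, hy⟩
  by_contra! hno
  have hsub : P ∩ intPoints n ⊆ {x | l x < l y} := fun s hs => by
    by_contra hlt
    exact hno s ⟨hs.1, fun z hz => (hy.2 z hz).trans (not_lt.1 hlt)⟩ hs.2
  have hconv : Convex ℝ {x | l x < l y} := convex_halfSpace_lt l.isLinear _
  have : l y < l y := convexHull_min hsub hconv (hP ▸ hy.1)
  exact lt_irrefl _ this

/-- A face of a Minkowski sum is the sum of faces of the summands. -/
lemma IsFace.exists_add {n : ℕ} {P₁ P₂ F : Set (Fin n → ℝ)} (hF : IsFace (P₁ + P₂) F) :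
    ∃ F₁ F₂, IsFace P₁ F₁ ∧ IsFace P₂ F₂ ∧ F = F₁ + F₂ := by
  obtain ⟨⟨y, hy⟩, hexp⟩ := hF
  obtain ⟨l, rfl⟩ := hexp ⟨y, hy⟩
  have key : ∀ y₁ ∈ P₁, ∀ y₂ ∈ P₂, (∀ z ∈ P₁ + P₂, l z ≤ l (y₁ + y₂)) →
      (∀ z ∈ P₁, l z ≤ l y₁) ∧ ∀ z ∈ P₂, l z ≤ l y₂ := fun y₁ h₁ y₂ h₂ hmax =>
    ⟨fun z hz => by simpa using hmax _ (Set.add_mem_add hz h₂),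
      fun z hz => by simpa using hmax _ (Set.add_mem_add h₁ hz)⟩
  obtain ⟨⟨y₁, h₁, y₂, h₂, rfl⟩, hmax⟩ := hy
  have hk := key y₁ h₁ y₂ h₂ hmax
  refine ⟨{x ∈ P₁ | ∀ z ∈ P₁, l z ≤ l x}, {x ∈ P₂ | ∀ z ∈ P₂, l z ≤ l x},
    ⟨⟨y₁, h₁, hk.1⟩, fun _ => ⟨l, rfl⟩⟩, ⟨⟨y₂, h₂, hk.2⟩, fun _ => ⟨l, rfl⟩⟩, ?_⟩
  ext x
  constructor
  · rintro ⟨⟨x₁, hx₁, x₂, hx₂, rfl⟩, hx⟩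
    have hkx := key x₁ hx₁ x₂ hx₂ hx
    exact Set.add_mem_add ⟨hx₁, hkx.1⟩ ⟨hx₂, hkx.2⟩
  · rintro ⟨x₁, hx₁, x₂, hx₂, rfl⟩
    refine ⟨Set.add_mem_add hx₁.1 hx₂.1, ?_⟩
    rintro _ ⟨z₁, hz₁, z₂, hz₂, rfl⟩
    simpa using add_le_add (hx₁.2 z₁ hz₁) (hx₂.2 z₂ hz₂)

lemma vectorSpan_add_of_nonempty {k V : Type*} [Ring k] [AddCommGroup V] [Module k V]
    {s t : Set V} (hs : s.Nonempty) (ht : t.Nonempty) :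
    vectorSpan k (s + t) = vectorSpan k s ⊔ vectorSpan k t := by
  obtain ⟨a, ha⟩ := hs
  obtain ⟨b, hb⟩ := ht
  apply le_antisymm
  · rw [vectorSpan_def, Submodule.span_le]
    rintro _ ⟨_, ⟨u, hu, v, hv, rfl⟩, _, ⟨u', hu', v', hv', rfl⟩, rfl⟩
    simp only [vsub_eq_sub, add_sub_add_comm]
    exact Submodule.add_mem_sup (vsub_mem_vectorSpan k hu hu') (vsub_mem_vectorSpan k hv hv')
  · refine sup_le ?_ ?_ <;> rw [vectorSpan_def k, Submodule.span_le]
    · rintro _ ⟨u, hu, v, hv, rfl⟩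
      simpa using vsub_mem_vectorSpan k (Set.add_mem_add hu hb) (Set.add_mem_add hv hb)
    · rintro _ ⟨u, hu, v, hv, rfl⟩
      simpa using vsub_mem_vectorSpan k (Set.add_mem_add ha hu) (Set.add_mem_add ha hv)

/-! ### Integer vectors and unimodular matrices -/

/-- The integer points, as an additive subgroup of `ℝⁿ`. -/
def intPointsSubgroup (n : ℕ) : AddSubgroup (Fin n → ℝ) where
  carrier := intPoints n
  zero_mem' := fun _ => ⟨0, by simp⟩
  add_mem' := fun {x y} hx hy i => by
    obtain ⟨k, hk⟩ := hx i
    obtain ⟨k', hk'⟩ := hy i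
    exact ⟨k + k', by simp [hk, hk']⟩
  neg_mem' := fun {x} hx i => by
    obtain ⟨k, hk⟩ := hx i
    exact ⟨-k, by simp [hk]⟩

lemma mem_intPointsSubgroup {n : ℕ} {x : Fin n → ℝ} :
    x ∈ intPointsSubgroup n ↔ x ∈ intPoints n := Iff.rfl

section Unimodular

variable {n m : ℕ} {A : Matrix (Fin n) (Fin m) ℤ}

lemma IsUnimodular.span_range_column (hA : IsUnimodular A) :
    Submodule.span ℝ (Set.range (column A)) = ⊤ := by
  apply Submodule.eq_top_of_finrank_eq
  have h := hA.1
  rw [Matrix.rank_eq_finrank_span_cols] at h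
  rw [Module.finrank_fin_fun]
  exact h

/-- Coordinates of an integer vector in a basis of columns of a unimodular matrix are integers,
by Cramer's rule. -/
lemma IsUnimodular.coeff_mem_intPoints (hA : IsUnimodular A) {f : Fin n → Fin m}
    (hf : LinearIndependent ℝ (column A ∘ f)) {c : Fin n → ℝ}
    (hc : ∑ i, c i • column A (f i) ∈ intPoints n) : c ∈ intPoints n := by
  set B := A.submatrix id f with hB
  set B' : Matrix (Fin n) (Fin n) ℝ := B.map (Int.cast : ℤ → ℝ) with hB'
  have hdet' : B'.det = (B.det : ℝ) := ((Int.castRingHom ℝ).map_det B).symm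
  have hne : B.det ≠ 0 := fun h0 => by
    have hu : IsUnit B' := by
      rw [← Matrix.linearIndependent_cols_iff_isUnit]
      exact hf
    rw [Matrix.isUnit_iff_isUnit_det, hdet', h0] at hu
    simp at hu
  have hsq : B.det * B.det = 1 := by
    rcases hA.2 f hf.injective.of_comp with h | h | h
    · exact absurd h hne
    · rw [h]; rfl
    · rw [h]; rfl
  choose u hu using hc
  have hBc : B' *ᵥ c = fun i => (u i : ℝ) := by
    ext i
    rw [← hu i]
    simp [Matrix.mulVec, dotProduct, hB', hB, column, mul_comm]
  have hadj : B'.det • c = B'.adjugate *ᵥ fun i => (u i : ℝ) := by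
    rw [← hBc, Matrix.mulVec_mulVec, Matrix.adjugate_mul, Matrix.smul_mulVec, Matrix.one_mulVec]
  have hadj' : B'.adjugate = B.adjugate.map (Int.cast : ℤ → ℝ) :=
    ((Int.castRingHom ℝ).map_adjugate B).symm
  intro i
  refine ⟨B.det * (B.adjugate *ᵥ u) i, ?_⟩
  have hi := congrFun hadj i
  rw [hadj', hdet', Pi.smul_apply, smul_eq_mul] at hi
  have hcast : (B.adjugate.map (Int.cast : ℤ → ℝ) *ᵥ fun i => (u i : ℝ)) i
      = ((B.adjugate *ᵥ u) i : ℤ) := by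
    simp [Matrix.mulVec, dotProduct]
  rw [Int.cast_mul, ← hcast, ← hi, ← mul_assoc]
  have hsq' : (B.det : ℝ) * B.det = 1 := by exact_mod_cast hsq
  rw [hsq', one_mul]

/-- An integer vector in the sum of two subspaces spanned by columns of a unimodular matrix is a
sum of integer vectors of these subspaces. -/
lemma IsUnimodular.exists_add_of_mem_sup (hA : IsUnimodular A) (J₁ J₂ : Set (Fin m))
    {u : Fin n → ℝ} (hu : u ∈ intPoints n)
    (hmem : u ∈ Submodule.span ℝ (column A '' J₁) ⊔ Submodule.span ℝ (column A '' J₂)) :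
    ∃ v₁ ∈ Submodule.span ℝ (column A '' J₁), ∃ v₂ ∈ Submodule.span ℝ (column A '' J₂),
      v₁ ∈ intPoints n ∧ v₂ ∈ intPoints n ∧ u = v₁ + v₂ := by
  classical
  -- A basis `K` of the sum consisting of columns, extended to a basis `L` of the whole space.
  obtain ⟨K, hK, -, hKspan, hKli⟩ := exists_linearIndepOn_extension
    (linearIndepOn_empty ℝ (column A)) (Set.empty_subset (J₁ ∪ J₂))
  obtain ⟨L, -, hKL, hLspan, hLli⟩ := exists_linearIndepOn_extension hKli (Set.subset_univ K)
  have hLtop : Submodule.span ℝ (column A '' L) = ⊤ := by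
    rw [eq_top_iff, ← hA.span_range_column, Submodule.span_le, ← Set.image_univ]
    exact hLspan
  have hcard : Fintype.card L = n := by
    have h := finrank_span_eq_card (R := ℝ) hLli
    rw [← Set.image_eq_range, hLtop, finrank_top, Module.finrank_fin_fun] at h
    exact h.symm
  let e : Fin n ≃ L := (Fintype.equivFinOfCardEq hcard).symm
  rw [← Submodule.span_union, ← Set.image_union] at hmem
  have hmem' : u ∈ Submodule.span ℝ (column A '' K) := Submodule.span_le.2 hKspan hmem
  obtain ⟨c, hcK, rfl⟩ := (Finsupp.mem_span_image_iff_linearCombination ℝ).1 hmem'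
  rw [Finsupp.mem_supported] at hcK
  rw [Finsupp.linearCombination_apply, Finsupp.sum] at hu ⊢
  have hsum : ∑ j ∈ c.support, c j • column A j = ∑ i, c (e i) • column A (e i) := by
    rw [e.sum_comp (fun j : L => c j • column A j),
      ← Finset.sum_subtype (p := fun j => j ∈ L) (Finset.univ.filter fun j => j ∈ L) (by simp)
        (fun j => c j • column A j)]
    refine Finset.sum_subset (fun j hj => by simpa using hKL (hcK hj)) fun j _ hj => ?_
    simp [Finsupp.notMem_support_iff.1 hj]
  have hint : ∀ j ∈ c.support, ∃ k : ℤ, c j = k := fun j hj => by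
    have h := hA.coeff_mem_intPoints (f := fun i => (e i : Fin m)) (hLli.comp e e.injective)
      (c := fun i => c (e i)) (hsum ▸ hu) (e.symm ⟨j, hKL (hcK hj)⟩)
    simpa using h
  have hterm : ∀ j ∈ c.support, c j • column A j ∈ intPointsSubgroup n := fun j hj i => by
    obtain ⟨k, hk⟩ := hint j hj
    exact ⟨k * A i j, by simp [hk, column]⟩
  refine ⟨∑ j ∈ c.support with j ∈ J₁, c j • column A j, ?_,
    ∑ j ∈ c.support with j ∉ J₁, c j • column A j, ?_, ?_, ?_,
    (Finset.sum_filter_add_sum_filter_not _ _ _).symm⟩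
  · refine Submodule.sum_mem _ fun j hj => Submodule.smul_mem _ _ (Submodule.subset_span ?_)
    exact ⟨j, (Finset.mem_filter.1 hj).2, rfl⟩
  · refine Submodule.sum_mem _ fun j hj => Submodule.smul_mem _ _ (Submodule.subset_span ?_)
    have hj' := Finset.mem_filter.1 hj
    exact ⟨j, (hK (hcK hj'.1)).resolve_left hj'.2, rfl⟩
  · exact mem_intPointsSubgroup.1 <| sum_mem fun j hj => hterm j (Finset.mem_filter.1 hj).1
  · exact mem_intPointsSubgroup.1 <| sum_mem fun j hj => hterm j (Finset.mem_filter.1 hj).1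

end Unimodular

/-! ### Minkowski sums in the family of a unimodular matrix -/

section Sum

variable {n m : ℕ} {A : Matrix (Fin n) (Fin m) ℤ} {P₁ P₂ : Set (Fin n → ℝ)}

lemma inter_intPoints_add_subset :
    (P₁ ∩ intPoints n) + (P₂ ∩ intPoints n) ⊆ (P₁ + P₂) ∩ intPoints n := by
  rintro _ ⟨x, hx, y, hy, rfl⟩
  exact ⟨Set.add_mem_add hx.1 hy.1, (intPointsSubgroup n).add_mem hx.2 hy.2⟩

lemma IsIntegerPolyhedron.add (h₁ : IsIntegerPolyhedron P₁) (h₂ : IsIntegerPolyhedron P₂) :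
    IsIntegerPolyhedron (P₁ + P₂) := by
  have hpoly : IsPolyhedral (P₁ + P₂) :=
    (isPolyhedron_iff_isPolyhedral.1 h₁.1).add (isPolyhedron_iff_isPolyhedral.1 h₂.1)
  refine ⟨isPolyhedron_iff_isPolyhedral.2 hpoly, Set.Subset.antisymm ?_ ?_⟩
  · calc P₁ + P₂ = convexHull ℝ (P₁ ∩ intPoints n) + convexHull ℝ (P₂ ∩ intPoints n) := by
          rw [← h₁.2, ← h₂.2]
      _ = convexHull ℝ ((P₁ ∩ intPoints n) + (P₂ ∩ intPoints n)) := (convexHull_add _ _).symm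
      _ ⊆ _ := convexHull_mono inter_intPoints_add_subset
  · refine convexHull_min Set.inter_subset_left (Convex.add ?_ ?_)
    · rw [h₁.2]; exact convex_convexHull _ _
    · rw [h₂.2]; exact convex_convexHull _ _

lemma add_mem_polyhedraOf (h₁ : P₁ ∈ polyhedraOf A) (h₂ : P₂ ∈ polyhedraOf A) :
    P₁ + P₂ ∈ polyhedraOf A := by
  refine ⟨h₁.1.add h₂.1, fun F hF => ?_⟩
  obtain ⟨F₁, F₂, hF₁, hF₂, rfl⟩ := hF.exists_add
  obtain ⟨J₁, hJ₁⟩ := h₁.2 F₁ hF₁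
  obtain ⟨J₂, hJ₂⟩ := h₂.2 F₂ hF₂
  refine ⟨J₁ ∪ J₂, ?_⟩
  rw [vectorSpan_add_of_nonempty hF₁.1 hF₂.1, hJ₁, hJ₂, Set.image_union, Submodule.span_union]

/-- Integer points of a sum decompose into integer points of the summands. -/
lemma IsUnimodular.add_inter_intPoints (hA : IsUnimodular A) (h₁ : P₁ ∈ polyhedraOf A)
    (h₂ : P₂ ∈ polyhedraOf A) :
    (P₁ + P₂) ∩ intPoints n = (P₁ ∩ intPoints n) + (P₂ ∩ intPoints n) := by
  refine Set.Subset.antisymm ?_ inter_intPoints_add_subset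
  rintro x ⟨⟨p₁, hp₁, p₂, hp₂, hx⟩, hxint⟩
  obtain ⟨ι, _, f, b, hP₁⟩ := isPolyhedron_iff_isPolyhedral.1 h₁.1.1
  obtain ⟨κ, _, g, c, hP₂⟩ := isPolyhedron_iff_isPolyhedral.1 h₂.1.1
  -- The constraints `f i z ≤ b i` and `g j (x - z) ≤ c j` describe `P₁ ∩ (x - P₂)`.
  obtain ⟨y, hy, hmove⟩ := exists_add_mem_of_active (Sum.elim f fun j => -g j)
    (Sum.elim b fun j => c j - g j x) ⟨p₁, by
      rw [hP₁] at hp₁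
      rw [hP₂] at hp₂
      subst hx
      rintro (i | j)
      · exact hp₁ i
      · have h : g j p₂ ≤ c j := hp₂ j
        simp only [Sum.elim_inr, LinearMap.neg_apply, map_add]
        linarith⟩
  simp only [Sum.forall, Sum.elim_inl, Sum.elim_inr, LinearMap.neg_apply, map_add,
    neg_eq_zero] at hy hmove
  obtain ⟨F₁, hF₁, hyF₁, hV₁⟩ := exists_isFace_active f b hy.1
  obtain ⟨F₂, hF₂, hyF₂, hV₂⟩ := exists_isFace_active g c (y := x - y) fun j => by
    rw [map_sub]; linarith [hy.2 j]
  rw [← hP₁] at hF₁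
  rw [← hP₂] at hF₂
  obtain ⟨a₁, ha₁, ha₁int⟩ := hF₁.exists_mem_intPoints h₁.1.2
  obtain ⟨a₂, ha₂, ha₂int⟩ := hF₂.exists_mem_intPoints h₂.1.2
  obtain ⟨J₁, hJ₁⟩ := h₁.2 F₁ hF₁
  obtain ⟨J₂, hJ₂⟩ := h₂.2 F₂ hF₂
  have hd₁ : y - a₁ ∈ vectorSpan ℝ F₁ := vsub_mem_vectorSpan ℝ hyF₁ ha₁
  have hd₂ : x - y - a₂ ∈ vectorSpan ℝ F₂ := vsub_mem_vectorSpan ℝ hyF₂ ha₂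
  have hu : x - a₁ - a₂ ∈ intPoints n := (intPointsSubgroup n).sub_mem
    ((intPointsSubgroup n).sub_mem hxint ha₁int) ha₂int
  have hmem : x - a₁ - a₂ ∈ vectorSpan ℝ F₁ ⊔ vectorSpan ℝ F₂ := by
    have h := Submodule.add_mem_sup hd₁ hd₂
    rwa [show y - a₁ + (x - y - a₂) = x - a₁ - a₂ by abel] at h
  rw [hJ₁, hJ₂] at hmem
  obtain ⟨v₁, hv₁, v₂, hv₂, hv₁int, hv₂int, hv⟩ := hA.exists_add_of_mem_sup J₁ J₂ hu hmem
  rw [← hJ₁] at hv₁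
  rw [← hJ₂] at hv₂
  -- `a₁ + v₁` differs from `y` by a vector `w` lying in both direction spaces.
  set w := a₁ + v₁ - y with hw
  have hw₁ : w ∈ vectorSpan ℝ F₁ := by
    rw [show w = v₁ - (y - a₁) by rw [hw]; abel]
    exact sub_mem hv₁ hd₁
  have hxv : x = a₁ + a₂ + v₁ + v₂ := by
    rw [add_assoc _ v₁, ← hv]; abel
  have hw₂ : w ∈ vectorSpan ℝ F₂ := by
    rw [show w = x - y - a₂ - v₂ by rw [hw, hxv]; abel]
    exact sub_mem hd₂ hv₂
  have hQ := hmove w ⟨fun i => hV₁ w hw₁ i, fun j hj => hV₂ w hw₂ j (by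
    rw [map_sub]; linarith)⟩
  refine ⟨a₁ + v₁, ⟨?_, (intPointsSubgroup n).add_mem ha₁int hv₁int⟩,
    a₂ + v₂, ⟨?_, (intPointsSubgroup n).add_mem ha₂int hv₂int⟩, ?_⟩
  · rw [hP₁, show a₁ + v₁ = y + w by rw [hw]; abel]
    exact fun i => by simpa using hQ.1 i
  · rw [hP₂, show a₂ + v₂ = x - y - w by rw [hw, hxv]; abel]
    intro j
    rw [map_sub, map_sub]
    linarith [hQ.2 j]
  · simp only [hxv]
    abel

end Sum

end DiscreteConvexity

theorem mainTheorem1 {n m : ℕ} (A : Matrix (Fin n) (Fin m) ℤ)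
    (hA : DiscreteConvexity.IsUnimodular A) :
    (DiscreteConvexity.DCP1 (DiscreteConvexity.polyhedraOf A) ∧
      DiscreteConvexity.DCP2 (DiscreteConvexity.polyhedraOf A)) ∧
    (DiscreteConvexity.DC1
        (DiscreteConvexity.discreteFamily (DiscreteConvexity.polyhedraOf A)) ∧
      DiscreteConvexity.DC2
        (DiscreteConvexity.discreteFamily (DiscreteConvexity.polyhedraOf A))) := by
  refine ⟨⟨fun P hP => hP.1, fun P₁ h₁ P₂ h₂ =>
    ⟨DiscreteConvexity.add_mem_polyhedraOf h₁ h₂, hA.add_inter_intPoints h₁ h₂⟩⟩, ?_, ?_⟩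
  · rintro _ ⟨P, hP, rfl⟩
    rw [← hP.1.2]
    exact ⟨hP.1, rfl⟩
  · rintro _ ⟨P₁, h₁, rfl⟩ _ ⟨P₂, h₂, rfl⟩
    exact ⟨P₁ + P₂, DiscreteConvexity.add_mem_polyhedraOf h₁ h₂,
      (hA.add_inter_intPoints h₁ h₂).symm⟩
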